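/- Let $G$ be a connected (real, finite-dimensional) Lie group with identity $e$ and Lie algebra $\mathfrak g=T_eG$ (with the usual bracket, so that $\operatorname{ad}$ is the differential of $\operatorname{Ad}$). For $Z\in\mathfrak g$ denote also by $Z$ the right invariant vector field on $G$ with value $Z$ at $e$, and by $dI\,Z$ the left invariant vector field induced from it by the inversion $I(g)=g^{-1}$. A smooth vector field on $G$ is called linear if its flow is a one-parameter group of automorphisms of $G$; a linear vector field $\mathcal X$ yields the derivation $Z\mapsto-[\mathcal X,Z]$ (Lie bracket of vector fields) of $\mathfrak g$, where right invariant vector fields are identified with their values at $e$. Let $\mathcal X_0,\dots,\mathcal X_m$ be linear vector fields on $G$ with $[\mathcal X_i,\mathcal X_j]=0$ for all $i,j$, let $Y_0,\dots,Y_m\in\mathfrak g$, and suppose that the derivation $\mathcal D_i$ of each $\mathcal X_i$ is inner, $\mathcal D_i=\operatorname{ad}(X_i)$ with $X_i\in\mathfrak g$. Then $\mathcal X_i=X_i+dI\,X_i$ for $i=0,\dots,m$. Moreover, write $X=X_0$, $Y=Y_0$, let $u=(u_1,\dots,u_m)\in\mathbb R^m$ be a constant control and put $u_0=1$. Then the solution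 with initial value $e$ of the affine system $$\frac{dg}{dt}=(\mathcal X_0+Y_0)(g)+\sum_{j=1}^m u_j(\mathcal X_j+Y_j)(g)$$ exists for all $t\in\mathbb R$, is unique (also on every open interval around $0$), and is $$\phi_t(e,u)=\exp\Big(tX+tY+\sum_{j=1}^m u_jt\,(X_j+Y_j)\Big)\exp\Big(-t\sum_{i=0}^m u_iX_i\Big).$$ -/

import Mathlib

open scoped Manifold ContDiff
open VectorField

namespace AffineControl

variable {E : Type*} [NormedAddCommGroup E] [NormedSpace ℝ E]
  {H : Type*} [TopologicalSpace H] {I : ModelWithCorners ℝ E H}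
  {G : Type*} [TopologicalSpace G] [ChartedSpace H G] [Group G]

/-- The right invariant vector field `g ↦ d(R_g)_e v` on `G` with value `v` at the identity.
Every right invariant vector field is of this form for exactly one `v`. -/
noncomputable def rightInvariantField (v : GroupLieAlgebra I G) (g : G) : TangentSpace I g :=
  (mfderiv I I (fun x : G => x * g) (1 : G) v : E)

/-- The vector field induced from the right invariant vector field of `v` by the inversion
`x ↦ x⁻¹`, that is, its push-forward `g ↦ d(inv)_{g⁻¹} (v(g⁻¹))`. It is left invariant. -/
noncomputable def inversionField (v : GroupLieAlgebra I G) (g : G) : TangentSpace I g :=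
  (mfderiv I I (fun x : G => x⁻¹) g⁻¹ (rightInvariantField (I := I) v g⁻¹) : E)

open Classical in
/-- The exponential map of the Lie group: `lieExp v` is the value at time `1` of the integral curve
through the identity of the right invariant vector field of `v`. (In a Lie group this global
integral curve exists and is unique, so that the value `1` of the second branch is never used.) -/
noncomputable def lieExp (v : GroupLieAlgebra I G) : G :=
  if h : ∃ γ : ℝ → G, γ 0 = 1 ∧ IsMIntegralCurve γ (rightInvariantField (I := I) v) then
    h.choose 1
  else 1

/-- A linear vector field on a Lie group: a smooth vector field which has a global flow
`(φ t)_{t ∈ ℝ}` that is a one-parameter group of (smooth) automorphisms of `G`. -/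
structure IsLinearField [IsManifold I 1 G] (𝒳 : (g : G) → TangentSpace I g) : Prop where
  smooth : ContMDiff I I.tangent ∞ (fun g : G => (⟨g, 𝒳 g⟩ : TangentBundle I G))
  exists_flow : ∃ φ : ℝ → MulAut G,
    (∀ s t : ℝ, φ (s + t) = φ s * φ t) ∧
    (∀ t : ℝ, ContMDiff I I ∞ (φ t : G → G)) ∧
    ∀ g : G, IsMIntegralCurve (fun t : ℝ => φ t g) 𝒳

/-- The derivation `Z ↦ -[𝒳, Z]` of a linear vector field `𝒳`, on right invariant vector fields `Z`,
which are identified with their values at the identity. -/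
noncomputable def linearDerivation (𝒳 : (g : G) → TangentSpace I g) (v : GroupLieAlgebra I G) :
    GroupLieAlgebra I G :=
  -mlieBracket I 𝒳 (rightInvariantField (I := I) v) (1 : G)

/-- The right-hand side `(𝒳₀ + Y₀) + ∑ⱼ uⱼ (𝒳ⱼ + Yⱼ)`, `j = 1, …, m`, of the affine system for the
constant control `u = (u₁, …, uₘ)`. Here `𝒳 0`, `Y 0` are the drift terms, and the `j`-th control,
`j : Fin m`, goes with the fields of index `j.succ`. -/
noncomputable def affineField {m : ℕ} (𝒳 : Fin (m + 1) → (g : G) → TangentSpace I g)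
    (Y : Fin (m + 1) → GroupLieAlgebra I G) (u : Fin m → ℝ) (g : G) : TangentSpace I g :=
  (𝒳 0 g + rightInvariantField (Y 0) g) +
    ∑ j : Fin m, u j • (𝒳 j.succ g + rightInvariantField (Y j.succ) g)

end AffineControl

/-! Write `R_v`, `L_v` for the right and left invariant fields of `v`. Inversion pushes `R_v` to
`-L_v`, so the first claim is `𝒳 = R_X - L_X`. Differentiating `φ_t(gh) = φ_t(g) φ_t(h)` shows that
a linear field is multiplicative: `𝒳(gh) = dR_h 𝒳(g) + dL_g 𝒳(h)`. So is `R_X - L_X`, hence also the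
difference `Z` of the two fields. The left coefficient `c(g) = dL_{g⁻¹} Z(g)` is then a cocycle,
`c(gh) = Ad(h⁻¹) c(g) + c(h)`, so it vanishes at `1` and its derivative vanishes everywhere once it
does at `1`. There the derivative in direction `v` is `[R_v, Z](1)` (`mlieBracket_eq_of_eq_zero`),
which is zero because both fields induce `ad X`; for `R_X - L_X` this rests on `[L_v, R_w](1) = 0`
(`mlieBracket_left_right`). Connectedness gives `c = 0`.

The affine field thus becomes `R_A - L_B` with constant `A`, `B`. Since `exp (t v)` is an integral
curve of both `R_v` and `L_v`, the product rule shows that `exp (tA) exp (-tB)` solves the system;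
uniqueness is that of integral curves of a smooth field. -/

namespace AffineControl

/-! ### Derivatives of translations, multiplication and inversion. -/

section TranslationDerivatives

variable {E : Type*} [NormedAddCommGroup E] [NormedSpace ℝ E]
  {H : Type*} [TopologicalSpace H] (I : ModelWithCorners ℝ E H)
  {G : Type*} [TopologicalSpace G] [ChartedSpace H G] [Group G]

/-- The derivative at `x` of the left translation by `g`, as a map on the model space. -/
noncomputable def leftD (g x : G) : E →L[ℝ] E := mfderiv I I (fun y : G => g * y) x

/-- The derivative at `x` of the right translation by `g`, as a map on the model space. -/
noncomputable def rightD (g x : G) : E →L[ℝ] E := mfderiv I I (fun y : G => y * g) x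

lemma leftD_one (x : G) : leftD I 1 x = ContinuousLinearMap.id ℝ E := by
  have : (fun y : G => 1 * y) = id := funext one_mul
  rw [leftD, this]
  exact mfderiv_id (I := I) (x := x)

lemma rightD_one (x : G) : rightD I 1 x = ContinuousLinearMap.id ℝ E := by
  have : (fun y : G => y * 1) = id := funext mul_one
  rw [rightD, this]
  exact mfderiv_id (I := I) (x := x)

variable [LieGroup I ∞ G]

lemma hasMFDerivAt_leftD (g x : G) : HasMFDerivAt I I (fun y : G => g * y) x (leftD I g x : E →L[ℝ] E) :=
  ((contMDiff_mul_left (I := I) (n := ∞) (a := g)).mdifferentiable (by simp) x).hasMFDerivAt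

lemma hasMFDerivAt_rightD (g x : G) : HasMFDerivAt I I (fun y : G => y * g) x (rightD I g x : E →L[ℝ] E) :=
  ((contMDiff_mul_right (I := I) (n := ∞) (a := g)).mdifferentiable (by simp) x).hasMFDerivAt

lemma leftD_mul (g h x : G) : leftD I (g * h) x = (leftD I g (h * x)).comp (leftD I h x) := by
  have h1 := (hasMFDerivAt_leftD I g (h * x)).comp x (hasMFDerivAt_leftD I h x)
  have h2 := hasMFDerivAt_leftD I (g * h) x
  have e : (fun y : G => g * y) ∘ (fun y : G => h * y) = fun y : G => (g * h) * y := by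
    ext y; simp [mul_assoc]
  rw [e] at h1
  exact hasMFDerivAt_unique h2 h1

lemma rightD_mul (g h x : G) : rightD I (g * h) x = (rightD I h (x * g)).comp (rightD I g x) := by
  have h1 := (hasMFDerivAt_rightD I h (x * g)).comp x (hasMFDerivAt_rightD I g x)
  have h2 := hasMFDerivAt_rightD I (g * h) x
  have e : (fun y : G => y * h) ∘ (fun y : G => y * g) = fun y : G => y * (g * h) := by
    ext y; simp [mul_assoc]
  rw [e] at h1
  exact hasMFDerivAt_unique h2 h1

lemma leftD_comp_rightD (g h x : G) :
    (leftD I g (x * h)).comp (rightD I h x) = (rightD I h (g * x)).comp (leftD I g x) := by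
  have h1 := (hasMFDerivAt_leftD I g (x * h)).comp x (hasMFDerivAt_rightD I h x)
  have h2 := (hasMFDerivAt_rightD I h (g * x)).comp x (hasMFDerivAt_leftD I g x)
  have e : (fun y : G => g * y) ∘ (fun y : G => y * h) =
      (fun y : G => y * h) ∘ (fun y : G => g * y) := by
    ext y; simp [mul_assoc]
  rw [e] at h1
  exact hasMFDerivAt_unique h1 h2

lemma leftD_inv_leftD (g x : G) (a : E) : leftD I g⁻¹ (g * x) (leftD I g x a) = a := by
  have h := leftD_mul I g⁻¹ g x
  rw [inv_mul_cancel, leftD_one] at h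
  exact (DFunLike.congr_fun h a).symm

lemma leftD_leftD_inv (g x : G) (a : E) : leftD I g (g⁻¹ * x) (leftD I g⁻¹ x a) = a := by
  simpa using leftD_inv_leftD I g⁻¹ x a

lemma rightD_inv_rightD (g x : G) (a : E) : rightD I g⁻¹ (x * g) (rightD I g x a) = a := by
  have h := rightD_mul I g g⁻¹ x
  rw [mul_inv_cancel, rightD_one] at h
  exact (DFunLike.congr_fun h a).symm

lemma rightD_rightD_inv (g x : G) (a : E) : rightD I g (x * g⁻¹) (rightD I g⁻¹ x a) = a := by
  simpa using rightD_inv_rightD I g⁻¹ x a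

variable {I}

/-- The product rule in a Lie group. -/
lemma hasMFDerivAt_mul {E' : Type*} [NormedAddCommGroup E'] [NormedSpace ℝ E']
    {H' : Type*} [TopologicalSpace H'] {J : ModelWithCorners ℝ E' H'}
    {M : Type*} [TopologicalSpace M] [ChartedSpace H' M] {f h : M → G} {x : M}
    {f' h' : E' →L[ℝ] E} (hf : HasMFDerivAt J I f x f') (hh : HasMFDerivAt J I h x h') :
    HasMFDerivAt J I (fun y => f y * h y) x
      ((rightD I (h x) (f x)).comp f' + (leftD I (f x) (h x)).comp h' : E' →L[ℝ] E) := by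
  have hm : MDifferentiableAt (I.prod I) I (fun p : G × G => p.1 * p.2) (f x, h x) :=
    (contMDiff_mul I ∞ (G := G)).mdifferentiable (by simp) _
  have hc := hm.hasMFDerivAt.comp x (hf.prodMk hh)
  refine hc.congr_mfderiv ?_
  rw [mfderiv_prod_eq_add_comp hm]
  ext v
  rfl

variable (I) in
-- Differentiate `y * y⁻¹ = 1` by the product rule and solve for the derivative of the inverse.
lemma hasMFDerivAt_inv (x : G) : HasMFDerivAt I I (fun y : G => y⁻¹) x
    (-((leftD I x⁻¹ 1).comp (rightD I x⁻¹ x)) : E →L[ℝ] E) := by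
  have h1 : HasMFDerivAt I I (fun y : G => y⁻¹) x (mfderiv I I (fun y : G => y⁻¹) x) :=
    ((contMDiff_inv I ∞ (G := G)).mdifferentiable (by simp) x).hasMFDerivAt
  refine h1.congr_mfderiv ?_
  have h2 := hasMFDerivAt_mul (hasMFDerivAt_id (I := I) x) h1
  have h3 : HasMFDerivAt I I (fun _ : G => (1 : G)) x (0 : E →L[ℝ] E) := hasMFDerivAt_const _ _
  have e : (fun y : G => id y * y⁻¹) = fun _ => 1 := by ext y; simp
  rw [e] at h2
  have h4 := hasMFDerivAt_unique h3 h2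
  refine ContinuousLinearMap.ext fun a => ?_
  have h5 := congrArg (leftD I x⁻¹ 1) (DFunLike.congr_fun h4 a)
  have h6 := leftD_inv_leftD I x x⁻¹ ((mfderiv I I (fun y : G => y⁻¹) x : E →L[ℝ] E) a)
  rw [mul_inv_cancel] at h6
  change leftD I x⁻¹ 1 0 = leftD I x⁻¹ 1 (rightD I x⁻¹ x a +
    leftD I x x⁻¹ ((mfderiv I I (fun y : G => y⁻¹) x : E →L[ℝ] E) a)) at h5
  rw [map_zero, map_add, h6] at h5
  exact (neg_eq_of_add_eq_zero_right h5.symm).symm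

lemma inversionField_eq (v : GroupLieAlgebra I G) (g : G) :
    inversionField v g = -mulInvariantVectorField v g := by
  have h := (hasMFDerivAt_inv I g⁻¹).mfderiv
  have h2 := rightD_inv_rightD I g⁻¹ 1 v
  rw [one_mul] at h2
  change (mfderiv I I (fun x : G => x⁻¹) g⁻¹ : E →L[ℝ] E) (rightD I g⁻¹ 1 v) = -(leftD I g 1 v)
  rw [h]
  change -(leftD I g⁻¹⁻¹ 1 (rightD I g⁻¹⁻¹ g⁻¹ (rightD I g⁻¹ 1 v))) = _
  rw [h2, inv_inv]

end TranslationDerivatives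

/-! ### Smoothness of invariant vector fields. -/

section Smoothness

variable {E : Type*} [NormedAddCommGroup E] [NormedSpace ℝ E]
  {H : Type*} [TopologicalSpace H] {I : ModelWithCorners ℝ E H}
  {G : Type*} [TopologicalSpace G] [ChartedSpace H G] [Group G] [LieGroup I ∞ G]

/-- The group multiplication of the tangent bundle of a Lie group is smooth. -/
lemma contMDiff_tangent_mul {E' : Type*} [NormedAddCommGroup E'] [NormedSpace ℝ E']
    {H' : Type*} [TopologicalSpace H'] {J : ModelWithCorners ℝ E' H'}
    {M : Type*} [TopologicalSpace M] [ChartedSpace H' M] {a b : M → TangentBundle I G}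
    (ha : ContMDiff J I.tangent ∞ a) (hb : ContMDiff J I.tangent ∞ b) :
    ContMDiff J I.tangent ∞ (fun x => (⟨(a x).1 * (b x).1,
      (rightD I (b x).1 (a x).1 (a x).2 + leftD I (a x).1 (b x).1 (b x).2 : E)⟩ :
        TangentBundle I G)) := by
  have S₂ : ContMDiff (I.tangent.prod I.tangent) (I.prod I).tangent ∞
      (equivTangentBundleProd I G I G).symm := contMDiff_equivTangentBundleProd_symm
  have S₃ : ContMDiff (I.prod I).tangent I.tangent ∞
      (tangentMap (I.prod I) I (fun p : G × G => p.1 * p.2)) :=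
    ContMDiff.contMDiff_tangentMap (contMDiff_mul I ∞ (G := G)) (by simp)
  -- The product is the tangent map of multiplication, after identifying `TG × TG` with `T(G × G)`.
  refine ((S₃.comp S₂).comp (ha.prodMk hb)).congr fun x => ?_
  have hm : MDifferentiableAt (I.prod I) I (fun p : G × G => p.1 * p.2) ((a x).1, (b x).1) :=
    (contMDiff_mul I ∞ (G := G)).mdifferentiable (by simp) _
  exact congrArg (Bundle.TotalSpace.mk ((a x).1 * (b x).1))
    (DFunLike.congr_fun (mfderiv_prod_eq_add_comp hm) ((a x).2, (b x).2)).symm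

/-- In the group `TG`, this field is the product of the constant vector `v` at `1` with the zero
section. -/
lemma contMDiff_rightInvariantField (v : GroupLieAlgebra I G) :
    ContMDiff I I.tangent ∞ (fun g : G => (⟨g, rightInvariantField v g⟩ : TangentBundle I G)) := by
  have ha : ContMDiff I I.tangent ∞ (fun _ : G => (⟨1, v⟩ : TangentBundle I G)) := contMDiff_const
  have hb : ContMDiff I I.tangent ∞ (fun g : G => (⟨g, 0⟩ : TangentBundle I G)) :=
    Bundle.contMDiff_zeroSection ℝ (TangentSpace I (M := G))
  refine (contMDiff_tangent_mul ha hb).congr fun g => ?_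
  have h : (rightInvariantField v g : E) = rightD I g 1 v + leftD I 1 g 0 := by
    rw [map_zero, add_zero]; rfl
  refine Bundle.TotalSpace.ext (one_mul g).symm ?_
  change HEq (rightInvariantField v g : E) (rightD I g 1 v + leftD I 1 g 0 : E)
  exact heq_of_eq h

lemma contMDiff_leftInvariantField (v : GroupLieAlgebra I G) :
    ContMDiff I I.tangent ∞
      (fun g : G => (⟨g, mulInvariantVectorField v g⟩ : TangentBundle I G)) := by
  have ha : ContMDiff I I.tangent ∞ (fun _ : G => (⟨1, v⟩ : TangentBundle I G)) := contMDiff_const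
  have hb : ContMDiff I I.tangent ∞ (fun g : G => (⟨g, 0⟩ : TangentBundle I G)) :=
    Bundle.contMDiff_zeroSection ℝ (TangentSpace I (M := G))
  refine (contMDiff_tangent_mul hb ha).congr fun g => ?_
  have h : (mulInvariantVectorField v g : E) = rightD I 1 g 0 + leftD I g 1 v := by
    rw [map_zero, zero_add]; rfl
  refine Bundle.TotalSpace.ext (mul_one g).symm ?_
  change HEq (mulInvariantVectorField v g : E) (rightD I 1 g 0 + leftD I g 1 v : E)
  exact heq_of_eq h

omit [LieGroup I ∞ G] in
lemma rightInvariantField_add (v w : GroupLieAlgebra I G) :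
    rightInvariantField (v + w) = rightInvariantField v + rightInvariantField w :=
  funext fun g => map_add (rightD I g 1) v w

omit [LieGroup I ∞ G] in
lemma rightInvariantField_smul (c : ℝ) (v : GroupLieAlgebra I G) :
    rightInvariantField (c • v) = c • rightInvariantField v :=
  funext fun g => map_smul (rightD I g 1) c v

end Smoothness

/-! ### The exponential map and one-parameter subgroups. -/

section Exponential

variable {E : Type*} [NormedAddCommGroup E] [NormedSpace ℝ E]
  {H : Type*} [TopologicalSpace H] {I : ModelWithCorners ℝ E H}
  {G : Type*} [TopologicalSpace G] [ChartedSpace H G] [Group G] [LieGroup I ∞ G]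

lemma rightD_mul_one (g h : G) (v : E) : rightD I (g * h) 1 v = rightD I h g (rightD I g 1 v) := by
  have := DFunLike.congr_fun (rightD_mul I g h 1) v
  rwa [one_mul] at this

lemma leftD_mul_one (g h : G) (v : E) : leftD I (g * h) 1 v = leftD I g h (leftD I h 1 v) := by
  have := DFunLike.congr_fun (leftD_mul I g h 1) v
  rwa [mul_one] at this

lemma isMIntegralCurveOn_mul_right {v : GroupLieAlgebra I G} {γ : ℝ → G} {s : Set ℝ}
    (hγ : IsMIntegralCurveOn γ (rightInvariantField v) s) (h : G) :
    IsMIntegralCurveOn (fun t => γ t * h) (rightInvariantField v) s := by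
  intro t ht
  refine ((hasMFDerivAt_rightD I h (γ t)).comp_hasMFDerivWithinAt t (hγ t ht)).congr_mfderiv ?_
  refine ContinuousLinearMap.ext fun (a : ℝ) => ?_
  have key (w : E) : rightD I h (γ t) (a • rightD I (γ t) 1 w) = a • rightD I (γ t * h) 1 w := by
    rw [map_smul, rightD_mul_one]
  exact key v

variable [CompleteSpace E] [I.Boundaryless] [T2Space G]

omit [CompleteSpace E] in
lemma isMIntegralCurve_rightInvariantField_unique {v : GroupLieAlgebra I G} {γ δ : ℝ → G}
    (hγ : IsMIntegralCurve γ (rightInvariantField v))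
    (hδ : IsMIntegralCurve δ (rightInvariantField v)) (h : γ 0 = δ 0) : γ = δ :=
  isMIntegralCurve_Ioo_eq_of_contMDiff_boundaryless (t₀ := 0)
    ((contMDiff_rightInvariantField v).of_le (by simp)) hγ hδ h

/-- Right translates of one local integral curve give the same existence time at every point, which
forces completeness. -/
lemma exists_isMIntegralCurve_rightInvariantField (v : GroupLieAlgebra I G) :
    ∃ γ : ℝ → G, γ 0 = 1 ∧ IsMIntegralCurve γ (rightInvariantField v) := by
  have hv : ContMDiff I I.tangent 1
      (fun g : G => (⟨g, rightInvariantField v g⟩ : TangentBundle I G)) :=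
    (contMDiff_rightInvariantField v).of_le (by simp)
  obtain ⟨γ, h0, hγ⟩ := exists_isMIntegralCurveAt_of_contMDiffAt_boundaryless (t₀ := 0)
    (hv.contMDiffAt (x := 1))
  obtain ⟨ε, hε, hγ⟩ := isMIntegralCurveAt_iff'.1 hγ
  rw [Real.ball_eq_Ioo, zero_sub, zero_add] at hγ
  exact exists_isMIntegralCurve_of_isMIntegralCurveOn hv hε
    (fun g => ⟨fun t => γ t * g, by simp [h0], isMIntegralCurveOn_mul_right hγ g⟩) 1

/-- Uniqueness makes the choice in `lieExp` immaterial, and rescaling time turns the value at `1`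
into the value at `t`. -/
lemma lieExp_smul_eq {v : GroupLieAlgebra I G} {γ : ℝ → G} (h0 : γ 0 = 1)
    (hγ : IsMIntegralCurve γ (rightInvariantField v)) (t : ℝ) : lieExp (t • v) = γ t := by
  have hex := exists_isMIntegralCurve_rightInvariantField (t • v)
  have h2 : IsMIntegralCurve (γ ∘ (· * t)) (rightInvariantField (t • v)) := by
    rw [rightInvariantField_smul]
    exact hγ.comp_mul t
  have h3 := isMIntegralCurve_rightInvariantField_unique hex.choose_spec.2 h2
    (by simp [hex.choose_spec.1, h0])
  rw [lieExp, dif_pos hex, h3]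
  simp

lemma lieExp_zero : lieExp (0 : GroupLieAlgebra I G) = 1 := by
  obtain ⟨γ, h0, hγ⟩ := exists_isMIntegralCurve_rightInvariantField (0 : GroupLieAlgebra I G)
  simpa [h0] using lieExp_smul_eq h0 hγ 0

lemma isMIntegralCurve_lieExp (v : GroupLieAlgebra I G) :
    IsMIntegralCurve (fun t : ℝ => lieExp (t • v)) (rightInvariantField v) := by
  obtain ⟨γ, h0, hγ⟩ := exists_isMIntegralCurve_rightInvariantField v
  rwa [funext (lieExp_smul_eq h0 hγ)]

lemma lieExp_add_smul (v : GroupLieAlgebra I G) (s t : ℝ) :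
    lieExp ((s + t) • v) = lieExp (s • v) * lieExp (t • v) := by
  have h1 := (isMIntegralCurve_lieExp v).comp_add t
  have h2 := isMIntegralCurveOn_mul_right ((isMIntegralCurve_lieExp v).isMIntegralCurveOn Set.univ)
    (lieExp (t • v))
  rw [← isMIntegralCurve_iff_isMIntegralCurveOn] at h2
  refine congrFun (isMIntegralCurve_rightInvariantField_unique h1 h2 ?_) s
  simp [lieExp_zero]

/-- Write `exp (s v) = exp (t v) exp ((s - t) v)` and differentiate at `s = t`: the second factor
passes through `1` with velocity `v`. -/
lemma isMIntegralCurve_lieExp_mulInvariantVectorField (v : GroupLieAlgebra I G) :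
    IsMIntegralCurve (fun t : ℝ => lieExp (t • v)) (mulInvariantVectorField v) := by
  intro t
  have h1 := (isMIntegralCurve_lieExp v).comp_add (-t) t
  have e0 : lieExp ((t + -t) • v) = 1 := by simp [lieExp_zero]
  have h2 := (hasMFDerivAt_leftD I (lieExp (t • v)) (lieExp ((t + -t) • v))).comp t h1
  have e1 : (fun y => lieExp (t • v) * y) ∘ ((fun t : ℝ => lieExp (t • v)) ∘ fun x => x + -t) =
      fun t : ℝ => lieExp (t • v) := by
    ext s
    simp only [Function.comp_apply]
    rw [← lieExp_add_smul]
    congr 2; ring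
  rw [e1] at h2
  refine h2.congr_mfderiv ?_
  refine ContinuousLinearMap.ext fun (a : ℝ) => ?_
  change leftD I (lieExp (t • v)) (lieExp ((t + -t) • v)) (a • rightD I (lieExp ((t + -t) • v)) 1 v)
    = a • leftD I (lieExp (t • v)) 1 v
  rw [e0, rightD_one, map_smul]
  rfl

lemma rightInvariantField_lieExp (v : GroupLieAlgebra I G) (t : ℝ) :
    rightInvariantField v (lieExp (t • v)) = mulInvariantVectorField v (lieExp (t • v)) := by
  have h := hasMFDerivAt_unique (isMIntegralCurve_lieExp v t)
    (isMIntegralCurve_lieExp_mulInvariantVectorField v t)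
  have h1 : (1 : ℝ) • (rightInvariantField v (lieExp (t • v)) : E) =
    (1 : ℝ) • (mulInvariantVectorField v (lieExp (t • v)) : E) := DFunLike.congr_fun h (1 : ℝ)
  rwa [one_smul, one_smul] at h1

/-- The curve `exp (t a) exp (-t b)` solves `g' = a g - g b`. -/
lemma isMIntegralCurve_lieExp_mul_lieExp_neg (a b : GroupLieAlgebra I G) :
    IsMIntegralCurve (fun t : ℝ => lieExp (t • a) * lieExp (t • -b))
      (rightInvariantField a - mulInvariantVectorField b) := by
  intro t
  refine (hasMFDerivAt_mul (isMIntegralCurve_lieExp a t)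
    (isMIntegralCurve_lieExp_mulInvariantVectorField (-b) t)).congr_mfderiv ?_
  set g := lieExp (t • a)
  set h := lieExp (t • -b)
  refine ContinuousLinearMap.ext fun (c : ℝ) => ?_
  have key (v w : E) : rightD I h g (c • rightD I g 1 v) + leftD I g h (c • leftD I h 1 (-w)) =
      c • (rightD I (g * h) 1 v - leftD I (g * h) 1 w) := by
    rw [map_smul, map_smul, ← rightD_mul_one, ← leftD_mul_one, map_neg, smul_sub, smul_neg,
      sub_eq_add_neg]
  exact key a b

end Exponential

/-! ### Left trivialization and brackets at a zero of a field. -/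

section LeftCoefficient

variable {E : Type*} [NormedAddCommGroup E] [NormedSpace ℝ E]
  {H : Type*} [TopologicalSpace H] {I : ModelWithCorners ℝ E H}
  {G : Type*} [TopologicalSpace G] [ChartedSpace H G] [Group G]

/-- The coefficient function of a vector field in the left invariant trivialization of the tangent
bundle. -/
noncomputable def leftCoeff (U : (g : G) → TangentSpace I g) (g : G) : E := leftD I g⁻¹ g (U g)

variable [LieGroup I ∞ G]

lemma leftD_leftCoeff (U : (g : G) → TangentSpace I g) (g : G) :
    (U g : E) = leftD I g 1 (leftCoeff U g) := by
  have key (w : E) : w = leftD I g 1 (leftD I g⁻¹ g w) := by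
    simpa using (leftD_leftD_inv I g g w).symm
  exact key (U g)

omit [LieGroup I ∞ G] in
lemma leftCoeff_one (U : (g : G) → TangentSpace I g) : leftCoeff U 1 = U 1 := by
  have key (w : E) : leftD I (1 : G)⁻¹ 1 w = w := by rw [inv_one, leftD_one]; rfl
  exact key (U 1)

lemma contMDiff_leftCoeff {U : (g : G) → TangentSpace I g}
    (hU : ContMDiff I I.tangent ∞ (fun g : G => (⟨g, U g⟩ : TangentBundle I G))) :
    ContMDiff I 𝓘(ℝ, E) ∞ (leftCoeff U) := by
  have ha : ContMDiff I I.tangent ∞ (fun g : G => (⟨g⁻¹, 0⟩ : TangentBundle I G)) :=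
    (Bundle.contMDiff_zeroSection ℝ (TangentSpace I (M := G))).comp (contMDiff_inv I ∞)
  -- Multiplying by the zero vector at `g⁻¹` moves `U g` into the single fibre over `1`, where the
  -- trivialization is the identity.
  have hT : ContMDiff I I.tangent ∞ (fun g : G => (⟨1, leftCoeff (E := E) (I := I) U g⟩ : TangentBundle I G)) := by
    refine (contMDiff_tangent_mul ha hU).congr fun g => ?_
    have key (w : E) : leftD I g⁻¹ g w = rightD I g g⁻¹ 0 + leftD I g⁻¹ g w := by
      rw [map_zero, zero_add]
    refine Bundle.TotalSpace.ext (inv_mul_cancel g).symm ?_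
    exact heq_of_eq (key (U g))
  intro g
  refine (Bundle.contMDiffAt_totalSpace.1 (hT g)).2.congr_of_eventuallyEq ?_
  refine Filter.Eventually.of_forall fun h => ?_
  change leftCoeff U h = (trivializationAt E (TangentSpace I) (1 : G) ⟨1, leftCoeff (E := E) (I := I) U h⟩).2
  rw [TangentBundle.trivializationAt_apply]
  exact ((tangentBundleCore I G).coordChange_self (achart H (1 : G)) 1
    (mem_chart_source H (1 : G)) (leftCoeff U h)).symm

lemma mlieBracket_sum_smul [CompleteSpace E] {ι : Type*} (s : Finset ι) {V : (g : G) → TangentSpace I g}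
    {f : ι → G → ℝ} {W : ι → (g : G) → TangentSpace I g} {x : G}
    (hf : ∀ i, MDifferentiableAt I 𝓘(ℝ, ℝ) (f i) x)
    (hW : ∀ i, MDifferentiableAt I I.tangent
      (fun g : G => (⟨g, W i g⟩ : TangentBundle I G)) x) :
    MDifferentiableAt I I.tangent
      (fun g : G => (⟨g, (∑ i ∈ s, f i • W i) g⟩ : TangentBundle I G)) x ∧
    mlieBracket I V (∑ i ∈ s, f i • W i) x =
      ∑ i ∈ s, (mvfderiv I (f i) x (V x) • W i x + f i x • mlieBracket I V (W i) x) := by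
  classical
  induction s using Finset.induction_on with
  | empty =>
    simp only [Finset.sum_empty, mlieBracket_zero_right]
    exact ⟨((Bundle.contMDiff_zeroSection (n := 1) ℝ (TangentSpace I (M := G))).mdifferentiable
      (by simp)) x, rfl⟩
  | insert i s hi ih =>
    rw [Finset.sum_insert hi, Finset.sum_insert hi]
    have h1 : MDifferentiableAt I I.tangent
      (fun g : G => (⟨g, (f i • W i) g⟩ : TangentBundle I G)) x :=
      MDifferentiableAt.smul_section (hf i) (hW i)
    refine ⟨mdifferentiableAt_add_section h1 ih.1, ?_⟩
    rw [mlieBracket_add_right h1 ih.1, ih.2, mlieBracket_smul_right (hf i) (hW i)]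

/-- The bracket with a vector field vanishing at the identity is the derivative of its
coefficient function. -/
lemma mlieBracket_eq_of_eq_zero [FiniteDimensional ℝ E] {U V : (g : G) → TangentSpace I g} {f' : E →L[ℝ] E}
    (h0 : U 1 = 0) (hf : HasMFDerivAt I 𝓘(ℝ, E) (leftCoeff U) 1 f') :
    mlieBracket I V U 1 = f' (V 1) := by
  have : CompleteSpace E := FiniteDimensional.complete ℝ E
  let b := Module.finBasis ℝ E
  let l (i : Fin (Module.finrank ℝ E)) : E →L[ℝ] ℝ := LinearMap.toContinuousLinearMap (b.coord i)
  have hl (i) : HasMFDerivAt I 𝓘(ℝ, ℝ) (fun g => l i (leftCoeff U g)) 1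
      ((l i).comp f' : E →L[ℝ] ℝ) :=
    ((l i).hasMFDerivAt (x := leftCoeff U 1)).comp (1 : G) hf
  -- Expand `U` in the left invariant frame of a basis. In the Leibniz rule, the brackets with the
  -- frame carry coefficients that vanish at `1`, so only derivatives of coefficients survive.
  have hU : U = ∑ i, (fun g => l i (leftCoeff U g)) • mulInvariantVectorField (b i) := by
    funext g
    have key (w : E) : leftD I g 1 w = ∑ i, l i w • leftD I g 1 (b i) := by
      conv_lhs => rw [← b.sum_repr w]
      rw [map_sum]
      exact Finset.sum_congr rfl fun i _ => map_smul _ _ _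
    rw [Finset.sum_apply]
    exact (leftD_leftCoeff U g).trans (key _)
  have hb := (mlieBracket_sum_smul Finset.univ (V := V) (fun i => (hl i).mdifferentiableAt)
    (fun i => (contMDiff_leftInvariantField (I := I) (G := G) (b i)).mdifferentiable
      (by simp) 1)).2
  rw [← hU] at hb
  rw [hb]
  have key (w : E) : f' w = ∑ i, (l i (f' w) • leftD I (1 : G) 1 (b i)) := by
    rw [leftD_one]
    exact (b.sum_repr (f' w)).symm
  rw [key (V 1)]
  refine Finset.sum_congr rfl fun i _ => ?_
  have h2 : l i (leftCoeff U 1) = 0 := by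
    rw [leftCoeff_one, h0]; exact map_zero (l i)
  rw [h2, zero_smul, add_zero, mvfderiv, (hl i).mfderiv]
  rfl

end LeftCoefficient

/-! ### Left and right invariant fields commute at the identity. -/

section LeftRightBracket

variable {E : Type*} [NormedAddCommGroup E] [NormedSpace ℝ E] [FiniteDimensional ℝ E]
  {H : Type*} [TopologicalSpace H] {I : ModelWithCorners ℝ E H}
  {G : Type*} [TopologicalSpace G] [ChartedSpace H G] [Group G] [LieGroup I ∞ G]

omit [FiniteDimensional ℝ E] in
lemma mdifferentiableAt_rightInvariantField (v : GroupLieAlgebra I G) (g : G) :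
    MDifferentiableAt I I.tangent
      (fun g : G => (⟨g, rightInvariantField v g⟩ : TangentBundle I G)) g :=
  (contMDiff_rightInvariantField v).mdifferentiable (by simp) g

omit [FiniteDimensional ℝ E] in
lemma mdifferentiableAt_leftInvariantField (v : GroupLieAlgebra I G) (g : G) :
    MDifferentiableAt I I.tangent
      (fun g : G => (⟨g, mulInvariantVectorField v g⟩ : TangentBundle I G)) g :=
  (contMDiff_leftInvariantField v).mdifferentiable (by simp) g

omit [FiniteDimensional ℝ E] in
lemma contMDiff_right_sub_left (v : GroupLieAlgebra I G) :
    ContMDiff I I.tangent ∞ (fun g : G =>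
      (⟨g, (rightInvariantField v - mulInvariantVectorField v) g⟩ : TangentBundle I G)) :=
  (contMDiff_rightInvariantField v).sub_section (contMDiff_leftInvariantField v)

omit [FiniteDimensional ℝ E] [LieGroup I ∞ G] in
lemma right_sub_left_one (v : GroupLieAlgebra I G) :
    (rightInvariantField v - mulInvariantVectorField v) (1 : G) = 0 := by
  have key (w : E) : rightD I (1 : G) 1 w - leftD I (1 : G) 1 w = 0 := by
    rw [rightD_one, leftD_one, sub_self]
  exact key v

omit [FiniteDimensional ℝ E] in
lemma hasMFDerivAt_leftCoeff {U : (g : G) → TangentSpace I g}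
    (hU : ContMDiff I I.tangent ∞ (fun g : G => (⟨g, U g⟩ : TangentBundle I G))) (g : G) :
    HasMFDerivAt I 𝓘(ℝ, E) (leftCoeff U) g (mfderiv I 𝓘(ℝ, E) (leftCoeff U) g : E →L[ℝ] E) :=
  ((contMDiff_leftCoeff hU).mdifferentiable (by simp) g).hasMFDerivAt

lemma mlieBracket_right_sub_left (V : (g : G) → TangentSpace I g) (v : GroupLieAlgebra I G)
    (g : G) :
    mlieBracket I V (rightInvariantField v - mulInvariantVectorField v) g =
      mlieBracket I V (rightInvariantField v) g - mlieBracket I V (mulInvariantVectorField v) g := by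
  have : CompleteSpace E := FiniteDimensional.complete ℝ E
  have h := mlieBracket_add_right (V := V)
    ((contMDiff_right_sub_left v).mdifferentiable (by simp) g)
    (mdifferentiableAt_leftInvariantField v g)
  rw [sub_add_cancel] at h
  exact (sub_eq_of_eq_add h).symm

variable [I.Boundaryless] [T2Space G]

/-- `R_v - L_v` vanishes along `exp (t v)`, so its coefficient function has zero derivative at `1`
in direction `v`. -/
lemma mlieBracket_left_right_self (v : GroupLieAlgebra I G) :
    mlieBracket I (mulInvariantVectorField v) (rightInvariantField v) (1 : G) = 0 := by
  have : CompleteSpace E := FiniteDimensional.complete ℝ E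
  have h1 := mlieBracket_right_sub_left (mulInvariantVectorField v) v 1
  have h0 : mlieBracket I (mulInvariantVectorField v) (mulInvariantVectorField v) (1 : G) = 0 := by
    rw [mlieBracket_self]; rfl
  rw [h0, sub_zero] at h1
  obtain ⟨D, hD⟩ : ∃ D : E →L[ℝ] E, HasMFDerivAt I 𝓘(ℝ, E)
      (leftCoeff (rightInvariantField v - mulInvariantVectorField v)) (1 : G) D :=
    ⟨_, hasMFDerivAt_leftCoeff (contMDiff_right_sub_left v) 1⟩
  rw [← h1, mlieBracket_eq_of_eq_zero (right_sub_left_one v) hD]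
  have e : lieExp ((0 : ℝ) • v) = 1 := by rw [zero_smul, lieExp_zero]
  have hγ : HasMFDerivAt 𝓘(ℝ, ℝ) I (fun t : ℝ => lieExp (t • v)) 0
      ((1 : ℝ →L[ℝ] ℝ).smulRight (leftD I (1 : G) 1 v) : ℝ →L[ℝ] E) := by
    refine (isMIntegralCurve_lieExp_mulInvariantVectorField v 0).congr_mfderiv ?_
    refine ContinuousLinearMap.ext fun (a : ℝ) => ?_
    change a • leftD I (lieExp ((0 : ℝ) • v)) 1 v = a • leftD I (1 : G) 1 v
    rw [e]
  rw [← e] at hD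
  have h2 := hD.comp (0 : ℝ) hγ
  have h3 : leftCoeff (rightInvariantField v - mulInvariantVectorField v) ∘
      (fun t : ℝ => lieExp (t • v)) = fun _ => 0 := by
    funext t
    have key : (rightInvariantField v - mulInvariantVectorField v) (lieExp (t • v)) = 0 := by
      rw [Pi.sub_apply, rightInvariantField_lieExp, sub_self]
    simp only [Function.comp_apply, leftCoeff]
    rw [key]
    exact map_zero _
  rw [h3] at h2
  have h4 := hasMFDerivAt_unique h2 (hasMFDerivAt_const (0 : E) (0 : ℝ))
  have key (f' : E →L[ℝ] E) (w : E)
      (h : f'.comp ((1 : ℝ →L[ℝ] ℝ).smulRight w) = (0 : ℝ →L[ℝ] E)) : f' w = 0 := by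
    simpa using DFunLike.congr_fun h (1 : ℝ)
  exact key _ _ h4

/-- Polarization of the vanishing on the diagonal. -/
lemma mlieBracket_left_right_swap (v w : GroupLieAlgebra I G) :
    mlieBracket I (mulInvariantVectorField v) (rightInvariantField w) (1 : G) =
      -mlieBracket I (mulInvariantVectorField w) (rightInvariantField v) (1 : G) := by
  have : CompleteSpace E := FiniteDimensional.complete ℝ E
  have h := mlieBracket_left_right_self (v + w)
  have hL := mdifferentiableAt_leftInvariantField (I := I) (G := G)
  have hR := mdifferentiableAt_rightInvariantField (I := I) (G := G)
  rw [mulInvariantVectorField_add, mlieBracket_add_left (hL v 1) (hL w 1), rightInvariantField_add,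
    mlieBracket_add_right (hR v 1) (hR w 1), mlieBracket_add_right (hR v 1) (hR w 1),
    mlieBracket_left_right_self, mlieBracket_left_right_self, zero_add, add_zero] at h
  exact eq_neg_of_add_eq_zero_left h

omit [FiniteDimensional ℝ E] [I.Boundaryless] [T2Space G] in
-- Computes pullbacks under inversion, which involve the inverse of its derivative; as inversion is
-- an involution, that inverse is its derivative at `g⁻¹`.
lemma mfderiv_inv_inverse (g : G) (a b : E)
    (h : -(leftD I g⁻¹ 1 (rightD I g⁻¹ g a)) = b) :
    (mfderiv I I (fun x : G => x⁻¹) g).inverse b = a := by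
  have e : (fun y : G => y⁻¹) ∘ (fun y : G => y⁻¹) = id := by ext; simp
  have inv_comp (x : G) := (hasMFDerivAt_inv I x⁻¹).comp x (hasMFDerivAt_inv I x)
  rw [e] at inv_comp
  have h1 := hasMFDerivAt_unique (inv_comp g) (hasMFDerivAt_id g)
  have h2 := hasMFDerivAt_unique (inv_comp g⁻¹) (hasMFDerivAt_id g⁻¹)
  simp only [inv_inv] at h1 h2
  rw [(hasMFDerivAt_inv I g).mfderiv]
  refine (DFunLike.congr_fun (ContinuousLinearMap.inverse_eq h2 h1) b).trans ?_
  rw [← h]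
  exact DFunLike.congr_fun h1 a

omit [FiniteDimensional ℝ E] [I.Boundaryless] [T2Space G] in
lemma mpullback_inv_left (v : GroupLieAlgebra I G) :
    mpullback I I (fun x : G => x⁻¹) (mulInvariantVectorField v) = rightInvariantField (-v) := by
  funext g
  refine mfderiv_inv_inverse (E := E) (I := I) g (rightInvariantField (-v) g) (mulInvariantVectorField v g⁻¹) ?_
  have h2 (w : E) := rightD_rightD_inv I g⁻¹ 1 w
  simp only [one_mul, inv_inv] at h2
  have key (w : E) : -(leftD I g⁻¹ 1 (rightD I g⁻¹ g (rightD I g 1 (-w)))) = leftD I g⁻¹ 1 w := by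
    rw [h2, map_neg, neg_neg]
  exact key v

omit [FiniteDimensional ℝ E] [I.Boundaryless] [T2Space G] in
lemma mpullback_inv_right (v : GroupLieAlgebra I G) :
    mpullback I I (fun x : G => x⁻¹) (rightInvariantField v) = mulInvariantVectorField (-v) := by
  funext g
  refine mfderiv_inv_inverse (E := E) (I := I) g (mulInvariantVectorField (-v) g) (rightInvariantField v g⁻¹) ?_
  have h1 (w : E) := DFunLike.congr_fun (leftD_comp_rightD I g⁻¹ g⁻¹ g) w
  have h2 (w : E) := leftD_inv_leftD I g 1 w
  simp only [mul_inv_cancel, inv_mul_cancel, ContinuousLinearMap.comp_apply] at h1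
  simp only [mul_one] at h2
  have key (w : E) : -(leftD I g⁻¹ 1 (rightD I g⁻¹ g (leftD I g 1 (-w)))) = rightD I g⁻¹ 1 w := by
    rw [h1, h2, map_neg, neg_neg]
  exact key v

/-- Left and right invariant vector fields commute (at the identity). -/
lemma mlieBracket_left_right (v w : GroupLieAlgebra I G) :
    mlieBracket I (mulInvariantVectorField v) (rightInvariantField w) (1 : G) = 0 := by
  have : CompleteSpace E := FiniteDimensional.complete ℝ E
  have hL := mdifferentiableAt_leftInvariantField (I := I) (G := G)
  have hR := mdifferentiableAt_rightInvariantField (I := I) (G := G)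
  have : IsManifold I (minSmoothness ℝ 2) G := by
    rw [minSmoothness_of_isRCLikeNormedField]; infer_instance
  -- Inversion exchanges `L_v` with `R_{-v}`, so the pulled-back bracket at `1` is `[R_{-v},
  -- L_{-w}](1)`, equal to `[L_v, R_w](1)` by antisymmetry. But the derivative of inversion at `1`
  -- is `-id`, whence `-c = c`.
  have h := mpullback_mlieBracket (I := I) (I' := I) (n := ∞) (f := fun x : G => x⁻¹) (x₀ := 1)
    (hL v _) (hR w _) (contMDiff_inv I ∞).contMDiffAt
    (by rw [minSmoothness_of_isRCLikeNormedField]; exact ENat.LEInfty.out)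
  have e1 : mlieBracket I (rightInvariantField (-v)) (mulInvariantVectorField (-w)) (1 : G) =
      mlieBracket I (mulInvariantVectorField v) (rightInvariantField w) (1 : G) := by
    rw [mlieBracket_swap_apply, ← neg_one_smul ℝ v, ← neg_one_smul ℝ w,
      mulInvariantVectorField_smul, rightInvariantField_smul, mlieBracket_const_smul_left (hL _ _),
      mlieBracket_const_smul_right (hR _ _), smul_smul, neg_one_mul, neg_neg, one_smul,
      ← mlieBracket_left_right_swap]
  rw [mpullback_inv_left, mpullback_inv_right, e1] at h
  set c := mlieBracket I (mulInvariantVectorField v) (rightInvariantField w) (1 : G) with hc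
  have h3 : mpullback I I (fun x : G => x⁻¹)
      (mlieBracket I (mulInvariantVectorField v) (rightInvariantField w)) 1 = (-c : E) := by
    refine mfderiv_inv_inverse (I := I) (1 : G) (-c : E) _ ?_
    have key (x : E) : -(leftD I (1 : G)⁻¹ 1 (rightD I (1 : G)⁻¹ 1 (-x))) = x := by
      rw [inv_one, leftD_one, rightD_one]; exact neg_neg x
    have hg (g : G) (hg : g = 1) : (c : E) =
        (mlieBracket I (mulInvariantVectorField v) (rightInvariantField w) g : E) := by
      subst hg; rfl
    exact (key c).trans (hg _ inv_one)
  have h4 : (-c : E) = c := h3.symm.trans h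
  have key (x : E) (hx : -x = x) : x = 0 := by
    have h2 : (2 : ℝ) • x = 0 := by
      rw [two_smul, ← sub_neg_eq_add, hx, sub_self]
    simpa using h2
  exact key c h4

end LeftRightBracket

/-! ### Vanishing derivative and connectedness. -/

section LocallyConstant

/-- A function with vanishing derivative on a connected boundaryless manifold is constant. -/
lemma eq_of_hasMFDerivAt_zero {E : Type*} [NormedAddCommGroup E] [NormedSpace ℝ E]
    {H : Type*} [TopologicalSpace H] {I : ModelWithCorners ℝ E H} [I.Boundaryless]
    {M : Type*} [TopologicalSpace M] [ChartedSpace H M] [IsManifold I 1 M] [ConnectedSpace M]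
    {F : Type*} [NormedAddCommGroup F] [NormedSpace ℝ F] {f : M → F}
    (hf : ∀ x, HasMFDerivAt I 𝓘(ℝ, F) f x (0 : E →L[ℝ] F)) (x y : M) : f x = f y := by
  have hloc : IsLocallyConstant f := by
    rw [IsLocallyConstant.iff_eventually_eq]
    intro x
    obtain ⟨r, hr, hball⟩ := Metric.mem_nhds_iff.1 (extChartAt_target_mem_nhds (I := I) x)
    have hd (z : E) (hz : z ∈ Metric.ball (extChartAt I x x) r) :
        HasFDerivAt (f ∘ (extChartAt I x).symm) (0 : E →L[ℝ] F) z := by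
      have h1 : MDifferentiableAt 𝓘(ℝ, E) I (extChartAt I x).symm z :=
        ((contMDiffOn_extChartAt_symm (n := 1) x).contMDiffAt
          (Filter.mem_of_superset (Metric.isOpen_ball.mem_nhds hz) hball)).mdifferentiableAt
          (by simp)
      exact hasMFDerivAt_iff_hasFDerivAt.1
        (((hf _).comp z h1.hasMFDerivAt).congr_mfderiv (ContinuousLinearMap.zero_comp _))
    have hconst (z : E) (hz : z ∈ Metric.ball (extChartAt I x x) r) :
        (f ∘ (extChartAt I x).symm) z = (f ∘ (extChartAt I x).symm) (extChartAt I x x) :=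
      (convex_ball _ _).is_const_of_fderivWithin_eq_zero (𝕜 := ℝ)
        (fun w hw => (hd w hw).differentiableAt.differentiableWithinAt)
        (fun w hw => by
          rw [fderivWithin_of_isOpen Metric.isOpen_ball hw, (hd w hw).fderiv])
        hz (Metric.mem_ball_self hr)
    filter_upwards [extChartAt_source_mem_nhds (I := I) x,
      (continuousAt_extChartAt (I := I) x).preimage_mem_nhds (Metric.ball_mem_nhds _ hr)]
      with y hy hy'
    have h := hconst _ hy'
    rwa [Function.comp_apply, Function.comp_apply, (extChartAt I x).left_inv hy,
      extChartAt_to_inv] at h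
  exact hloc.apply_eq_of_preconnectedSpace x y

end LocallyConstant

/-! ### Multiplicative fields and the form of linear fields. -/

section LinearField

variable {E : Type*} [NormedAddCommGroup E] [NormedSpace ℝ E]
  {H : Type*} [TopologicalSpace H] {I : ModelWithCorners ℝ E H}
  {G : Type*} [TopologicalSpace G] [ChartedSpace H G] [Group G] [LieGroup I ∞ G]

/-- A vector field on a Lie group is multiplicative if, in the right (or left) trivialization,
it is a cocycle for the adjoint representation. -/
def IsMultiplicativeField (U : (g : G) → TangentSpace I g) : Prop :=
  ∀ g h : G, (U (g * h) : E) = (rightD I h g (U g) + leftD I g h (U h) : E)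

/-- Differentiate `φ_t(gh) = φ_t(g) φ_t(h)` at `t = 0`. -/
lemma IsLinearField.isMultiplicativeField {𝒳 : (g : G) → TangentSpace I g}
    (h𝒳 : IsLinearField 𝒳) : IsMultiplicativeField 𝒳 := by
  obtain ⟨φ, hadd, -, hφ⟩ := h𝒳.exists_flow
  intro g h
  have h0 : φ 0 = 1 := by
    have := hadd 0 0
    rw [add_zero] at this
    exact left_eq_mul.1 this
  have h00 (x : G) : φ 0 x = x := by rw [h0]; rfl
  have hg : HasMFDerivAt 𝓘(ℝ, ℝ) I (fun t => φ t (g * h)) 0 _ := hφ (g * h) 0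
  have h1 := hasMFDerivAt_mul (hφ g 0) (hφ h 0)
  have e : (fun t => φ t g * φ t h) = fun t => φ t (g * h) := by
    funext t; exact (map_mul (φ t) g h).symm
  rw [e] at h1
  have h2 := DFunLike.congr_fun (hasMFDerivAt_unique hg h1) (1 : ℝ)
  have key (a b c : G) (ha : a = g * h) (hb : b = g) (hc : c = h)
      (h3 : (1 : ℝ) • (𝒳 a : E) =
        (rightD I c b ((1 : ℝ) • (𝒳 b : E)) + leftD I b c ((1 : ℝ) • (𝒳 c : E)) : E)) :
      (𝒳 (g * h) : E) = (rightD I h g (𝒳 g) + leftD I g h (𝒳 h) : E) := by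
    subst ha hb hc
    rwa [one_smul, one_smul, one_smul] at h3
  exact key _ _ _ (h00 _) (h00 _) (h00 _) h2

/-- The two mixed terms cancel because left and right translations commute. -/
lemma isMultiplicativeField_right_sub_left (v : GroupLieAlgebra I G) :
    IsMultiplicativeField (rightInvariantField v - mulInvariantVectorField v) := by
  intro g h
  have key (w : E) : rightD I (g * h) 1 w - leftD I (g * h) 1 w =
      rightD I h g (rightD I g 1 w - leftD I g 1 w) +
        leftD I g h (rightD I h 1 w - leftD I h 1 w) := by
    have h1 := DFunLike.congr_fun (leftD_comp_rightD I g h 1) w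
    simp only [one_mul, mul_one, ContinuousLinearMap.comp_apply] at h1
    rw [rightD_mul_one, leftD_mul_one, map_sub, map_sub, h1]
    abel
  exact key v

omit [LieGroup I ∞ G] in
lemma IsMultiplicativeField.sub {U V : (g : G) → TangentSpace I g}
    (hU : IsMultiplicativeField U) (hV : IsMultiplicativeField V) :
    IsMultiplicativeField (U - V) := by
  intro g h
  have key (a b c a' b' c' : E) (h1 : a = rightD I h g b + leftD I g h c)
      (h2 : a' = rightD I h g b' + leftD I g h c') :
      a - a' = rightD I h g (b - b') + leftD I g h (c - c') := by
    rw [h1, h2, map_sub, map_sub]; abel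
  exact key _ _ _ _ _ _ (hU g h) (hV g h)

omit [LieGroup I ∞ G] in
lemma IsMultiplicativeField.apply_one {U : (g : G) → TangentSpace I g}
    (hU : IsMultiplicativeField U) : U 1 = 0 := by
  have key (g : G) (a b : E) (hg : g = 1) (h : b = rightD I (1 : G) 1 a + leftD I (1 : G) 1 a)
      (hab : b = a) : a = 0 := by
    rw [rightD_one, leftD_one, hab] at h
    exact left_eq_add.1 h
  refine key 1 (U 1) (U (1 * 1)) rfl (hU 1 1) ?_
  rw [mul_one]

/-- The cocycle identity; the operator applied to `leftCoeff U g` is `Ad(h⁻¹)`. -/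
lemma IsMultiplicativeField.leftCoeff_mul {U : (g : G) → TangentSpace I g}
    (hU : IsMultiplicativeField U) (g h : G) :
    leftCoeff U (g * h) = leftD I h⁻¹ h (rightD I h 1 (leftCoeff U g)) + leftCoeff U h := by
  have key (a b : E) : leftD I (g * h)⁻¹ (g * h) (rightD I h g a + leftD I g h b) =
      leftD I h⁻¹ h (rightD I h 1 (leftD I g⁻¹ g a)) + leftD I h⁻¹ h b := by
    have h1 := DFunLike.congr_fun (leftD_comp_rightD I g⁻¹ h g) a
    simp only [inv_mul_cancel, ContinuousLinearMap.comp_apply] at h1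
    rw [mul_inv_rev, leftD_mul, inv_mul_cancel_left, ContinuousLinearMap.comp_apply, map_add,
      leftD_inv_leftD, h1, map_add]
  exact (congrArg (leftD I (g * h)⁻¹ (g * h)) (hU g h)).trans (key _ _)

lemma IsMultiplicativeField.hasMFDerivAt_zero {U : (g : G) → TangentSpace I g}
    (hU : IsMultiplicativeField U)
    (h0 : HasMFDerivAt I 𝓘(ℝ, E) (leftCoeff U) (1 : G) (0 : E →L[ℝ] E)) (h : G) :
    HasMFDerivAt I 𝓘(ℝ, E) (leftCoeff U) h (0 : E →L[ℝ] E) := by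
  have h1 := hasMFDerivAt_rightD I h⁻¹ h
  rw [← mul_inv_cancel h] at h0
  have h2 := h0.comp h h1
  let A : E →L[ℝ] E := (leftD I h⁻¹ h).comp (rightD I h 1)
  have h3 : HasMFDerivAt 𝓘(ℝ, E) 𝓘(ℝ, E) (fun w => A w + leftCoeff U h)
      ((leftCoeff U ∘ fun y => y * h⁻¹) h) A :=
    (A.hasFDerivAt.add_const _).hasMFDerivAt
  have h4 := h3.comp h h2
  -- By the cocycle identity for `g = (g h⁻¹) h`, the coefficient near `h` is an affine image of the
  -- coefficient near `1`.
  have e : (fun w => A w + leftCoeff U h) ∘ leftCoeff U ∘ (fun y => y * h⁻¹) = leftCoeff U := by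
    funext g
    have := hU.leftCoeff_mul (g * h⁻¹) h
    rw [inv_mul_cancel_right] at this
    exact this.symm
  rw [e] at h4
  refine h4.congr_mfderiv ?_
  ext w
  change A 0 = 0
  exact map_zero A

variable [FiniteDimensional ℝ E] [I.Boundaryless] [T2Space G]

/-- As `R_v - L_v` vanishes at `1`, only the value of the other field there matters, so `R_w` may be
replaced by `L_w`. Then `[L_w, R_v]` drops out and `-[L_w, L_v]` is left. -/
lemma mlieBracket_right_of_right_sub_left (v w : GroupLieAlgebra I G) :
    mlieBracket I (rightInvariantField w) (rightInvariantField v - mulInvariantVectorField v)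
      (1 : G) = ⁅v, w⁆ := by
  have : CompleteSpace E := FiniteDimensional.complete ℝ E
  have hD := hasMFDerivAt_leftCoeff (contMDiff_right_sub_left v) (1 : G)
  have h1 := mlieBracket_eq_of_eq_zero (V := rightInvariantField w) (right_sub_left_one v) hD
  have h2 := mlieBracket_eq_of_eq_zero (V := mulInvariantVectorField w) (right_sub_left_one v) hD
  have h3 : rightInvariantField w (1 : G) = mulInvariantVectorField w (1 : G) :=
    sub_eq_zero.1 (right_sub_left_one w)
  rw [h3, ← h2] at h1
  rw [h1, mlieBracket_right_sub_left, mlieBracket_left_right, zero_sub, GroupLieAlgebra.bracket_def, mlieBracket_swap_apply, neg_neg]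

/-- A linear vector field on a connected Lie group whose derivation is `ad X` is the difference of
the right and the left invariant vector fields of `X`. -/
theorem IsLinearField.eq_of_linearDerivation_eq [ConnectedSpace G]
    {𝒳 : (g : G) → TangentSpace I g} (h𝒳 : IsLinearField 𝒳) {X : GroupLieAlgebra I G}
    (hX : ∀ v : GroupLieAlgebra I G, linearDerivation 𝒳 v = ⁅X, v⁆) :
    𝒳 = rightInvariantField X - mulInvariantVectorField X := by
  have : CompleteSpace E := FiniteDimensional.complete ℝ E
  set W : (g : G) → TangentSpace I g := rightInvariantField X - mulInvariantVectorField X with hW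
  have hWs := contMDiff_right_sub_left X
  have hZm : IsMultiplicativeField (𝒳 - W) :=
    h𝒳.isMultiplicativeField.sub (isMultiplicativeField_right_sub_left X)
  have hZs : ContMDiff I I.tangent ∞
      (fun g : G => (⟨g, (𝒳 - W) g⟩ : TangentBundle I G)) := h𝒳.smooth.sub_section hWs
  have hD := hasMFDerivAt_leftCoeff hZs 1
  have hbr (v : GroupLieAlgebra I G) : mlieBracket I (rightInvariantField v) (𝒳 - W) 1 = 0 := by
    have h := mlieBracket_add_right (V := rightInvariantField v)
      (hZs.mdifferentiable (by simp) 1) (hWs.mdifferentiable (by simp) 1)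
    rw [← hW, sub_add_cancel, hW, mlieBracket_right_of_right_sub_left, ← hX, linearDerivation,
      mlieBracket_swap_apply] at h
    exact right_eq_add.1 h
  have h0 : HasMFDerivAt I 𝓘(ℝ, E) (leftCoeff (𝒳 - W)) (1 : G) (0 : E →L[ℝ] E) := by
    refine hD.congr_mfderiv (ContinuousLinearMap.ext fun v => ?_)
    have h1 := mlieBracket_eq_of_eq_zero (V := rightInvariantField v) hZm.apply_one hD
    have key (D : E →L[ℝ] E) (a b : E) (h : b = D (rightD I (1 : G) 1 a)) (hb : b = 0) :
        D a = 0 := by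
      rw [rightD_one] at h
      exact h.symm.trans hb
    exact key _ v _ h1 (hbr v)
  have hconst (g : G) : leftCoeff (𝒳 - W) g = 0 := by
    rw [eq_of_hasMFDerivAt_zero (hZm.hasMFDerivAt_zero h0) g 1, leftCoeff_one]
    exact hZm.apply_one
  funext g
  have h1 := leftD_leftCoeff (𝒳 - W) g
  rw [hconst, map_zero] at h1
  exact sub_eq_zero.1 h1

end LinearField

/-! ### The affine system as a difference of invariant fields. -/

section AffineField

variable {E : Type*} [NormedAddCommGroup E] [NormedSpace ℝ E]
  {H : Type*} [TopologicalSpace H] {I : ModelWithCorners ℝ E H}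
  {G : Type*} [TopologicalSpace G] [ChartedSpace H G] [Group G]

lemma affineField_eq {m : ℕ} {𝒳 : Fin (m + 1) → (g : G) → TangentSpace I g}
    {X : Fin (m + 1) → GroupLieAlgebra I G} (Y : Fin (m + 1) → GroupLieAlgebra I G)
    (h : ∀ i, 𝒳 i = rightInvariantField (X i) - mulInvariantVectorField (X i)) (u : Fin m → ℝ) :
    affineField 𝒳 Y u =
      rightInvariantField (X 0 + Y 0 + ∑ j : Fin m, u j • (X j.succ + Y j.succ)) -
        mulInvariantVectorField
          (∑ i : Fin (m + 1), (Fin.cons (1 : ℝ) u : Fin (m + 1) → ℝ) i • X i) := by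
  funext g
  have key (x y : Fin (m + 1) → E) (r l : E →L[ℝ] E) :
      ((r (x 0) - l (x 0)) + r (y 0)) +
        ∑ j : Fin m, u j • ((r (x j.succ) - l (x j.succ)) + r (y j.succ)) =
      r (x 0 + y 0 + ∑ j : Fin m, u j • (x j.succ + y j.succ)) -
        l (∑ i : Fin (m + 1), (Fin.cons (1 : ℝ) u : Fin (m + 1) → ℝ) i • x i) := by
    simp only [Fin.sum_univ_succ, Fin.cons_zero, Fin.cons_succ, one_smul, map_add, map_sum,
      map_smul, smul_add, smul_sub, Finset.sum_add_distrib, Finset.sum_sub_distrib]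
    abel
  have e : affineField 𝒳 Y u =
      affineField (fun i => rightInvariantField (X i) - mulInvariantVectorField (X i)) Y u := by
    rw [← funext h]
  rw [e]
  exact key X Y (rightD I g 1) (leftD I g 1)

end AffineField

end AffineControl

theorem theorem3p1
    {E : Type*} [NormedAddCommGroup E] [NormedSpace ℝ E] [FiniteDimensional ℝ E]
    {H : Type*} [TopologicalSpace H] {I : ModelWithCorners ℝ E H} [I.Boundaryless]
    {G : Type*} [TopologicalSpace G] [ChartedSpace H G] [Group G]
    [LieGroup I ∞ G] [T2Space G] [ConnectedSpace G]
    (m : ℕ)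
    (𝒳 : Fin (m + 1) → (g : G) → TangentSpace I g)
    (h𝒳 : ∀ i, AffineControl.IsLinearField (𝒳 i))
    (hcomm : ∀ i j, ∀ g : G, VectorField.mlieBracket I (𝒳 i) (𝒳 j) g = 0)
    (Y : Fin (m + 1) → GroupLieAlgebra I G)
    (X : Fin (m + 1) → GroupLieAlgebra I G)
    -- the derivations are inner: `D_i = ad (X_i)`
    (hinner : ∀ i, ∀ v : GroupLieAlgebra I G,
      AffineControl.linearDerivation (𝒳 i) v = ⁅X i, v⁆) :
    (∀ i, ∀ g : G, 𝒳 i g =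
      AffineControl.rightInvariantField (X i) g + AffineControl.inversionField (X i) g) ∧
    ∀ (u : Fin m → ℝ) (φ : ℝ → G),
      (∀ t : ℝ, φ t =
        AffineControl.lieExp (t • X 0 + t • Y 0 + ∑ j : Fin m, (u j * t) • (X j.succ + Y j.succ)) *
          AffineControl.lieExp
            (-(t • ∑ i : Fin (m + 1), (Fin.cons (1 : ℝ) u : Fin (m + 1) → ℝ) i • X i))) →
      -- `φ` is a solution on all of `ℝ` starting at the identity
      φ 0 = 1 ∧
      IsMIntegralCurve φ (AffineControl.affineField 𝒳 Y u) ∧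
      -- and every solution starting at the identity agrees with it
      ∀ (a b : ℝ) (ψ : ℝ → G), a < 0 → 0 < b → ψ 0 = 1 →
        IsMIntegralCurveOn ψ (AffineControl.affineField 𝒳 Y u) (Set.Ioo a b) →
        ∀ t ∈ Set.Ioo a b, ψ t = φ t := by
  have : CompleteSpace E := FiniteDimensional.complete ℝ E
  have hfield (i) : 𝒳 i = AffineControl.rightInvariantField (X i) - mulInvariantVectorField (X i) :=
    (h𝒳 i).eq_of_linearDerivation_eq (hinner i)
  refine ⟨fun i g => ?_, fun u φ hφ => ?_⟩
  · rw [AffineControl.inversionField_eq, ← sub_eq_add_neg, hfield i]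
    rfl
  rw [AffineControl.affineField_eq Y hfield u]
  set A := X 0 + Y 0 + ∑ j : Fin m, u j • (X j.succ + Y j.succ) with hA
  set B := ∑ i : Fin (m + 1), (Fin.cons (1 : ℝ) u : Fin (m + 1) → ℝ) i • X i with hB
  -- Pull the factor `t` out of both exponents.
  have hφ' : φ = fun t : ℝ => AffineControl.lieExp (t • A) * AffineControl.lieExp (t • -B) := by
    funext t
    simp only [hφ t, hA, smul_neg, smul_add t (X 0 + Y 0), smul_add t (X 0), Finset.smul_sum,
      smul_smul, mul_comm]
  have h0 : φ 0 = 1 := by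
    rw [hφ']
    simp [AffineControl.lieExp_zero]
  have hint : IsMIntegralCurve φ
      (AffineControl.rightInvariantField A - mulInvariantVectorField B) := by
    rw [hφ']
    exact AffineControl.isMIntegralCurve_lieExp_mul_lieExp_neg A B
  refine ⟨h0, hint, fun a b ψ ha hb hψ0 hψ => ?_⟩
  have hs : ContMDiff I I.tangent 1 (fun g : G => (⟨g, (AffineControl.rightInvariantField A -
      mulInvariantVectorField B) g⟩ : TangentBundle I G)) :=
    ((AffineControl.contMDiff_rightInvariantField A).sub_section
      (AffineControl.contMDiff_leftInvariantField B)).of_le (by simp)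
  exact isMIntegralCurveOn_Ioo_eqOn_of_contMDiff_boundaryless (t₀ := 0) ⟨ha, hb⟩ hs hψ
    (hint.isMIntegralCurveOn _) (hψ0.trans h0.symm)
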